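/- Let $\Gamma$ be a group of fractional linear transformations (for instance a Kleinian group), given by a subgroup of $\mathrm{GL}_2(\mathbb{C})$, where $\gamma=\begin{pmatrix}a&b\\c&d\end{pmatrix}$ acts by $\gamma(z)=\frac{az+b}{cz+d}$. For $\gamma(\infty)\neq\infty$ put $z_\gamma=\gamma^{-1}(\infty)=-d/c$ and $c_\gamma=\det\gamma/c^2$. Notation: $\pi_1(w)=\tfrac12(w-\bar w)$, applied also to complex-valued forms; $d\log f=df/f$; $$r_2(f,g)=\pi_1(d\log f)\,\log|g|-\log|f|\,\pi_1(d\log g);$$ $\mathcal{D}_2(z)=\arg(1-z)\log|z|+\operatorname{Im}\mathrm{Li}_2(z)$, with $\mathrm{Li}_2(z)=-\int_0^z\log(1-t)\,\frac{dt}{t}$, is the Bloch–Wigner dilogarithm and $\mathcal{L}_2=\sqrt{-1}\,\mathcal{D}_2$; further $$\kappa_\gamma=\log|c_\gamma|\;\pi_1\, d\log\gamma',\qquad (\check\delta\kappa)_{\gamma_1,\gamma_2}=\kappa_{\gamma_2}-\kappa_{\gamma_1\gamma_2}+\gamma_2^*\kappa_{\gamma_1}.$$ Let $\gamma_1,\gamma_2\in\Gamma$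 be such that none of $\gamma_1,\gamma_2,\gamma_1\gamma_2$ fixes $\infty$. Put $z_2=\gamma_2^{-1}(\infty)$, $z_{12}=(\gamma_1\gamma_2)^{-1}(\infty)$ and $T_{12}(z)=\frac{z-z_{12}}{z-z_2}$. Then, at every point of $\mathbb{C}\setminus\{z_2,z_{12}\}$, the function $\mathcal{L}_2\circ T_{12}$ is (real) differentiable and $$r_2\bigl((\gamma_1\gamma_2)',\gamma_2'\bigr)=4\,d\bigl(\mathcal{L}_2\circ T_{12}\bigr)+(\check\delta\kappa)_{\gamma_1,\gamma_2}.$$ -/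

import Mathlib

open scoped Matrix

noncomputable section

namespace BlochWigner

/-- Complex-valued `1`-forms on the plane: a real-linear functional on the tangent space `ℂ` at each
point. Equalities of such forms are asserted off finite sets of points. -/
abbrev OneForm : Type := ℂ → (ℂ →L[ℝ] ℂ)

/-- `π_p(z) = (z + (-1)^p z̄) / 2`, as a real-linear map. -/
def piP (p : ℕ) : ℂ →L[ℝ] ℂ :=
  (1 / 2 : ℝ) • (ContinuousLinearMap.id ℝ ℂ + ((-1 : ℝ) ^ p) • (Complex.conjCLE : ℂ →L[ℝ] ℂ))

/-- `π_p` applied to a complex-valued `1`-form. -/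
def piForm (p : ℕ) (ω : OneForm) : OneForm := fun z => (piP p).comp (ω z)

/-- The form `d log f = df / f`. -/
def dlog (f : ℂ → ℂ) : OneForm := fun z => (f z)⁻¹ • fderiv ℝ f z

/-- `r₂(f,g) = π₁(d log f) log|g| - log|f| π₁(d log g)`. -/
def r2 (f g : ℂ → ℂ) : OneForm := fun z =>
  Real.log ‖g z‖ • piForm 1 (dlog f) z - Real.log ‖f z‖ • piForm 1 (dlog g) z

/-- Euler's dilogarithm `Li₂(z) = -∫₀^z log(1-t) dt/t`, the integral being taken along the segment
from `0` to `z` with the principal branch of the logarithm. -/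
def Li2 (z : ℂ) : ℂ :=
  -∫ t in (0 : ℝ)..1, Complex.log (1 - (t : ℂ) * z) / (t : ℂ)

/-- The Bloch–Wigner dilogarithm `D₂(z) = arg(1-z) log|z| + Im Li₂(z)`. On the cut `(1,∞)` the
principal values `arg = π` make the two terms cancel, so that this is the continuous extension
(with value `0`) there; likewise at `0` and `1`. -/
def D2 (z : ℂ) : ℝ :=
  Complex.arg (1 - z) * Real.log ‖z‖ + (Li2 z).im

/-- `L₂ = √-1 · D₂`. -/
def L2 (z : ℂ) : ℂ := Complex.I * (D2 z : ℂ)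

/-- The fractional linear transformation `z ↦ (az+b)/(cz+d)` on the affine line. -/
def mobius (γ : GL (Fin 2) ℂ) (z : ℂ) : ℂ :=
  (γ 0 0 * z + γ 0 1) / (γ 1 0 * z + γ 1 1)

/-- `z_γ = γ⁻¹(∞) = -d/c`, for `γ` not fixing `∞`. -/
def pole (γ : GL (Fin 2) ℂ) : ℂ := -γ 1 1 / γ 1 0

/-- `c_γ = det γ / c²`, for `γ` not fixing `∞`; it does not change when the matrix is rescaled. -/
def cConst (γ : GL (Fin 2) ℂ) : ℂ := (γ : Matrix (Fin 2) (Fin 2) ℂ).det / γ 1 0 ^ 2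

/-- `T₁₂(z) = (z - z₁₂) / (z - z₂)`, where `z₂ = γ₂⁻¹(∞)` and `z₁₂ = (γ₁γ₂)⁻¹(∞)`. -/
def T (γ₁ γ₂ : GL (Fin 2) ℂ) (z : ℂ) : ℂ := (z - pole (γ₁ * γ₂)) / (z - pole γ₂)

/-- The right action of `γ` on `1`-forms, by pull-back. -/
def pullback (ω : OneForm) (γ : GL (Fin 2) ℂ) : OneForm := fun z =>
  (ω (mobius γ z)).comp (fderiv ℝ (mobius γ) z)

/-- The coboundary of a group `1`-cochain on `Γ` with values in `1`-forms:
`(δκ)_{γ₁,γ₂} = κ_{γ₂} - κ_{γ₁γ₂} + κ_{γ₁} · γ₂`. -/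
def coboundary {Γ : Subgroup (GL (Fin 2) ℂ)} (κ : Γ → OneForm) (γ₁ γ₂ : Γ) : OneForm := fun z =>
  κ γ₂ z - κ (γ₁ * γ₂) z + pullback (κ γ₁) γ₂ z

/-- The `1`-cochain `κ_γ = log|c_γ| π₁ d log γ'`. -/
def kappa {Γ : Subgroup (GL (Fin 2) ℂ)} (γ : Γ) : OneForm := fun z =>
  Real.log ‖cConst γ‖ • piForm 1 (dlog (deriv (mobius γ))) z

end BlochWigner

end

namespace BlochWigner

open Complex MeasureTheory intervalIntegral Set Filter Topology

/-! Put `u = z - z₁₂`, `v = z - z₂`, `δ = z₁₂ - z₂`. Since `γ' = c_γ / (z - z_γ)²`, both sides are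
combinations of `d arg u` and `d arg v` with coefficients built from `log|u|`, `log|v|` and
constants. As `T₁₂ = u/v` and `1 - T₁₂ = δ/v`, the formula `dD₂ = log|z| d arg(1-z) - log|1-z| d arg
z` accounts for the nonconstant coefficients (`dD2Coeff_div`). The constant ones match because `c₁₂
c₂ = δ² c₁` (`cConst_mul_cConst`). The analytic content is `hasFDerivAt_D2`, including on the cut
`(1,∞)`, where the principal branches jump. Off the cut, `Li₂` is differentiated under the integral.
Near the cut, `D₂(z) = -D₂(1/z)` moves the point to where the first case applies. -/

/-! ### The derivative of Euler's dilogarithm off the cut. -/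

lemma one_sub_mul_mem_slitPlane {z : ℂ} (hz : 1 - z ∈ slitPlane) {t : ℝ}
    (ht : t ∈ Icc (0 : ℝ) 1) : 1 - (t : ℂ) * z ∈ slitPlane := by
  have h := starConvex_one_slitPlane hz (sub_nonneg.2 ht.2) ht.1 (by ring)
  convert h using 1
  simp only [real_smul, ofReal_sub, ofReal_one]
  ring

/-- The singularity at `t = 0` is removable: as `log 1 = 0`, the integrand is a difference quotient
at `0`, which `dslope` extends continuously. -/
lemma intervalIntegrable_log_one_sub_mul_div {z : ℂ} {a : ℝ} (ha : 0 ≤ a)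
    (hz : ∀ t ∈ Icc 0 a, 1 - (t : ℂ) * z ∈ slitPlane) :
    IntervalIntegrable (fun t : ℝ => log (1 - (t : ℂ) * z) / (t : ℂ)) volume 0 a := by
  set f : ℝ → ℂ := fun t => log (1 - (t : ℂ) * z)
  set s : Set ℝ := {t | 1 - (t : ℂ) * z ∈ slitPlane}
  have hso : IsOpen s := isOpen_slitPlane.preimage (by fun_prop)
  have h0 : (0 : ℝ) ∈ s := by simp [s]
  have hf : ∀ t ∈ s, DifferentiableAt ℝ f t := fun t ht =>
    ((show DifferentiableAt ℝ (fun t : ℝ => 1 - (t : ℂ) * z) t by fun_prop).hasDerivAt.clog_real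
      ht).differentiableAt
  have hc : ContinuousOn (dslope f 0) s :=
    (continuousOn_dslope (hso.mem_nhds h0)).2
      ⟨fun t ht => (hf t ht).continuousAt.continuousWithinAt, hf 0 h0⟩
  have hi : IntervalIntegrable (dslope f 0) volume 0 a :=
    (hc.mono (by rw [uIcc_of_le ha]; exact hz)).intervalIntegrable
  refine hi.congr fun t ht => ?_
  rw [uIoc_of_le ha] at ht
  rw [dslope_of_ne _ ht.1.ne', slope_def_module]
  simp [f, div_eq_inv_mul]

lemma integral_inv_one_sub_mul {z : ℂ} (hz : 1 - z ∈ slitPlane) (h0 : z ≠ 0) :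
    ∫ t in (0 : ℝ)..1, (1 - (t : ℂ) * z)⁻¹ = -log (1 - z) / z := by
  have hne : ∀ t ∈ uIcc (0 : ℝ) 1, 1 - (t : ℂ) * z ∈ slitPlane := fun t ht =>
    one_sub_mul_mem_slitPlane hz (by rwa [uIcc_of_le zero_le_one] at ht)
  rw [integral_eq_sub_of_hasDerivAt (f := fun t : ℝ => -log (1 - (t : ℂ) * z) / z)]
  · simp
  · intro t ht
    have h1 : HasDerivAt (fun t : ℝ => 1 - (t : ℂ) * z) (-z) t := by
      simpa using ((ofRealCLM.hasDerivAt (x := t)).mul_const z).const_sub 1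
    refine ((h1.clog_real (hne t ht)).neg.div_const z).congr_deriv ?_
    have := slitPlane_ne_zero (hne t ht)
    field_simp
  · refine ContinuousOn.intervalIntegrable ?_
    exact ContinuousOn.inv₀ (by fun_prop) fun t ht => slitPlane_ne_zero (hne t ht)

lemma hasDerivAt_Li2 {z : ℂ} (hz : 1 - z ∈ slitPlane) (h0 : z ≠ 0) :
    HasDerivAt Li2 (-log (1 - z) / z) z := by
  have hUo : IsOpen {w : ℂ | 1 - w ∈ slitPlane} := isOpen_slitPlane.preimage (by fun_prop)
  obtain ⟨r, hr, hrs⟩ := Metric.nhds_basis_closedBall.mem_iff.1 (hUo.mem_nhds hz)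
  have hne : ∀ p ∈ Metric.closedBall z r ×ˢ Icc (0 : ℝ) 1, 1 - (p.2 : ℂ) * p.1 ∈ slitPlane :=
    fun p hp => one_sub_mul_mem_slitPlane (hrs hp.1) hp.2
  -- The `w`-derivative of the integrand is `-(1 - t w)⁻¹`: the factor `t` cancels, so compactness
  -- gives a constant dominating bound.
  obtain ⟨C, hC⟩ := ((isCompact_closedBall z r).prod
    (isCompact_Icc (a := (0 : ℝ)) (b := 1))).exists_bound_of_continuousOn
    (f := fun p : ℂ × ℝ => -(1 - (p.2 : ℂ) * p.1)⁻¹)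
    (ContinuousOn.neg (ContinuousOn.inv₀ (by fun_prop)
      fun p hp => slitPlane_ne_zero (hne p hp)))
  have hIcc : ∀ t ∈ uIoc (0 : ℝ) 1, t ∈ Icc (0 : ℝ) 1 := fun t ht => by
    rw [uIoc_of_le zero_le_one] at ht
    exact Ioc_subset_Icc_self ht
  have key := (hasDerivAt_integral_of_dominated_loc_of_deriv_le (μ := volume)
    (F := fun (w : ℂ) (t : ℝ) => log (1 - (t : ℂ) * w) / (t : ℂ))
    (F' := fun (w : ℂ) (t : ℝ) => -(1 - (t : ℂ) * w)⁻¹)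
    (a := 0) (b := 1) (bound := fun _ => C) (Metric.closedBall_mem_nhds z hr)
    (by
      filter_upwards [hUo.mem_nhds hz] with w hw
      rw [uIoc_of_le zero_le_one]
      exact (intervalIntegrable_log_one_sub_mul_div zero_le_one
        fun t ht => one_sub_mul_mem_slitPlane hw ht).1.aestronglyMeasurable)
    (intervalIntegrable_log_one_sub_mul_div zero_le_one
      fun t ht => one_sub_mul_mem_slitPlane hz ht)
    (by
      refine Measurable.aestronglyMeasurable ?_
      fun_prop)
    (ae_of_all _ fun t ht w hw => hC (w, t) ⟨hw, hIcc t ht⟩)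
    intervalIntegrable_const
    (ae_of_all _ fun t ht w hw => by
      have hm := hne (w, t) ⟨hw, hIcc t ht⟩
      have ht0 : (t : ℂ) ≠ 0 := by
        rw [uIoc_of_le zero_le_one] at ht
        exact_mod_cast ht.1.ne'
      have h1 : HasDerivAt (fun w : ℂ => 1 - (t : ℂ) * w) (-(t : ℂ)) w := by
        simpa using ((hasDerivAt_id w).const_mul (t : ℂ)).const_sub 1
      refine ((h1.clog hm).div_const (t : ℂ)).congr_deriv ?_
      have := slitPlane_ne_zero hm
      field_simp)).2
  rw [intervalIntegral.integral_neg, integral_inv_one_sub_mul hz h0] at key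
  exact key.neg.congr_deriv (by ring)

/-! ### Conjugation and the values of `D2` on the real axis. -/

lemma Li2_conj {z : ℂ} (hz : 1 - z ∈ slitPlane) :
    Li2 (starRingEnd ℂ z) = starRingEnd ℂ (Li2 z) := by
  simp only [Li2, map_neg]
  rw [← intervalIntegral_conj]
  congr 1
  refine integral_congr fun t ht => ?_
  rw [uIcc_of_le zero_le_one] at ht
  have := log_conj _ (mem_slitPlane_iff_arg.1 (one_sub_mul_mem_slitPlane hz ht)).1
  simp only [map_sub, map_one, map_mul, conj_ofReal] at this
  simp [this]

lemma arg_one_sub_of_le {y : ℝ} (h : y ≤ 1) : arg (1 - (y : ℂ)) = 0 := by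
  rw [← ofReal_one, ← ofReal_sub, arg_ofReal_of_nonneg (by linarith)]

lemma arg_one_sub_of_lt {y : ℝ} (h : 1 < y) : arg (1 - (y : ℂ)) = Real.pi := by
  rw [← ofReal_one, ← ofReal_sub, arg_ofReal_of_neg (by linarith)]

lemma intervalIntegrable_log_one_sub_ofReal_mul_div {x : ℝ} (hx : 1 < x) :
    IntervalIntegrable (fun t : ℝ => log (1 - (t : ℂ) * x) / (t : ℂ)) volume 0 1 := by
  have hx0 : 0 < x := by linarith
  have ha : 0 < 1 / (2 * x) := by positivity
  have hab : 1 / (2 * x) ≤ 1 / x := one_div_le_one_div_of_le hx0 (by linarith)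
  have hb1 : 1 / x ≤ 1 := by rw [div_le_one hx0]; linarith
  -- The cut point `1/(2x)` separates the removable singularity at `0` from the logarithmic one at
  -- `1/x`.
  refine (intervalIntegrable_log_one_sub_mul_div (a := 1 / (2 * x)) ha.le fun t ht => ?_).trans ?_
  · refine Or.inl ?_
    have := mul_le_mul_of_nonneg_right ht.2 hx0.le
    have h2 : 1 / (2 * x) * x = 1 / 2 := by field_simp
    simp
    linarith
  have harg : IntervalIntegrable (fun t : ℝ => arg (1 - ((t * x : ℝ) : ℂ))) volume
      (1 / (2 * x)) 1 := by
    refine IntervalIntegrable.trans (b := 1 / x)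
      ((intervalIntegrable_const (c := (0 : ℝ))).congr fun t ht => ?_)
      ((intervalIntegrable_const (c := Real.pi)).congr fun t ht => ?_)
    · rw [uIoc_of_le hab] at ht
      exact (arg_one_sub_of_le ((le_div_iff₀ hx0).1 ht.2)).symm
    · rw [uIoc_of_le hb1] at ht
      exact (arg_one_sub_of_lt ((div_lt_iff₀ hx0).1 ht.1)).symm
  have hlog : IntervalIntegrable (fun t : ℝ => Real.log (1 - t * x)) volume
      (1 / (2 * x)) 1 := by
    have h1 := (intervalIntegrable_log' (a := 1 - 1 / 2) (b := 1 - x)).comp_sub_left 1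
    have h2 := h1.comp_mul_right (c := x)
    convert h2 using 1 <;> field_simp <;> ring
  have hsum : IntervalIntegrable (fun t : ℝ => log (1 - (t : ℂ) * x)) volume
      (1 / (2 * x)) 1 := by
    have hlog' : IntervalIntegrable (fun t : ℝ => (Real.log (1 - t * x) : ℂ)) volume
        (1 / (2 * x)) 1 := ⟨hlog.1.ofReal, hlog.2.ofReal⟩
    have harg' : IntervalIntegrable (fun t : ℝ => (arg (1 - ((t * x : ℝ) : ℂ)) : ℂ)) volume
        (1 / (2 * x)) 1 := ⟨harg.1.ofReal, harg.2.ofReal⟩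
    have := hlog'.add (harg'.mul_const I)
    refine this.congr fun t _ => ?_
    simp only [log]
    congr 2
    · rw [← Real.log_abs, ← Real.norm_eq_abs, ← norm_real]
      push_cast
      rfl
    · push_cast; rfl
  simp only [div_eq_mul_inv]
  refine hsum.mul_continuousOn (ContinuousOn.inv₀ (by fun_prop) fun t ht => ?_)
  rw [uIcc_of_le (hab.trans hb1)] at ht
  exact_mod_cast (ha.trans_le ht.1).ne'

lemma im_log_div_ofReal (w : ℂ) (t : ℝ) : (log w / (t : ℂ)).im = arg w / t := by
  rw [div_ofReal_im, log_im]

/-- The imaginary part of the integrand is `0` up to `1/x` and `π/t` beyond, so `Im Li₂(x) = -π log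
x` cancels `arg(1-x) log x`. -/
lemma D2_ofReal_of_one_lt {x : ℝ} (hx : 1 < x) : D2 x = 0 := by
  have hx0 : 0 < x := by linarith
  have hb1 : 1 / x ≤ 1 := by rw [div_le_one hx0]; linarith
  have hb0 : 0 < 1 / x := by positivity
  have him := intervalIntegral_im (intervalIntegrable_log_one_sub_ofReal_mul_div hx)
  have e1 : EqOn (fun _ : ℝ => (0 : ℝ)) (fun t : ℝ => arg (1 - (t : ℂ) * x) / t)
      (uIoc 0 (1 / x)) := fun t ht => by
    rw [uIoc_of_le hb0.le] at ht
    have := arg_one_sub_of_le ((le_div_iff₀ hx0).1 ht.2)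
    push_cast at this
    simp [this]
  have e2 : EqOn (fun t : ℝ => Real.pi * t⁻¹) (fun t : ℝ => arg (1 - (t : ℂ) * x) / t)
      (uIoc (1 / x) 1) := fun t ht => by
    rw [uIoc_of_le hb1] at ht
    have := arg_one_sub_of_lt ((div_lt_iff₀ hx0).1 ht.1)
    push_cast at this
    simp [this, div_eq_mul_inv]
  have i2 : IntervalIntegrable (fun t : ℝ => Real.pi * t⁻¹) volume (1 / x) 1 := by
    refine ContinuousOn.intervalIntegrable (ContinuousOn.mul (by fun_prop)
      (ContinuousOn.inv₀ (by fun_prop) fun t ht => ?_))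
    rw [uIcc_of_le hb1] at ht
    exact (hb0.trans_le ht.1).ne'
  have hval : ∫ t in (0 : ℝ)..1, arg (1 - (t : ℂ) * x) / t = Real.pi * Real.log x := by
    rw [← integral_add_adjacent_intervals (b := 1 / x)
      ((intervalIntegrable_const (c := (0 : ℝ))).congr e1) (i2.congr e2),
      ← integral_congr_ae (ae_of_all _ e1), ← integral_congr_ae (ae_of_all _ e2), intervalIntegral.integral_const_mul,
      integral_inv_of_pos hb0 one_pos]
    simp
  have hL : (Li2 x).im = -(Real.pi * Real.log x) := by
    rw [← hval, Li2, neg_im]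
    congr 1
    refine Eq.trans him.symm (integral_congr fun t _ => ?_)
    exact im_log_div_ofReal _ _
  rw [D2, hL, arg_one_sub_of_lt hx, norm_real, Real.norm_of_nonneg hx0.le]
  ring

lemma D2_conj {z : ℂ} (hz : 1 - z ∈ slitPlane) : D2 (starRingEnd ℂ z) = -D2 z := by
  have h : arg (1 - starRingEnd ℂ z) = -arg (1 - z) := by
    rw [← map_one (starRingEnd ℂ), ← map_sub, map_one, arg_conj,
      if_neg (mem_slitPlane_iff_arg.1 hz).1]
  rw [D2, D2, h, Li2_conj hz, conj_im, norm_conj]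
  ring

lemma D2_ofReal_of_lt_one {x : ℝ} (hx : x < 1) : D2 x = 0 := by
  have h := D2_conj (z := x) (Or.inl (by simpa using hx))
  rw [conj_ofReal] at h
  linarith

/-- The real-linear functional `h ↦ Im (c h)`. -/
noncomputable def imMul (c : ℂ) : ℂ →L[ℝ] ℝ := imCLM.comp (ContinuousLinearMap.mul ℝ ℂ c)

@[simp] lemma imMul_apply (c h : ℂ) : imMul c h = (c * h).im := rfl

lemma piP_one_apply (w : ℂ) : piP 1 w = I * (w.im : ℂ) := by
  apply Complex.ext <;> simp [piP]
  ring

/-! ### Derivatives, poles and constants of fractional linear transformations. -/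

lemma hasDerivAt_mobius {γ : GL (Fin 2) ℂ} (hc : γ 1 0 ≠ 0) {z : ℂ} (hz : z ≠ pole γ) :
    HasDerivAt (mobius γ) (cConst γ / (z - pole γ) ^ 2) z := by
  have hd : γ 1 0 * z + γ 1 1 ≠ 0 := fun h => hz <| by
    rw [pole, eq_div_iff hc]
    linear_combination h
  have e : z - pole γ = (γ 1 0 * z + γ 1 1) / γ 1 0 := by
    rw [pole]
    field_simp
    ring
  have h1 : HasDerivAt (fun z => γ 0 0 * z + γ 0 1) (γ 0 0) z := by
    simpa using ((hasDerivAt_id z).const_mul (γ 0 0)).add_const (γ 0 1)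
  have h2 : HasDerivAt (fun z => γ 1 0 * z + γ 1 1) (γ 1 0) z := by
    simpa using ((hasDerivAt_id z).const_mul (γ 1 0)).add_const (γ 1 1)
  refine (h1.div h2 hd).congr_deriv ?_
  rw [e, cConst, Matrix.det_fin_two]
  field_simp
  ring

lemma cConst_ne_zero {γ : GL (Fin 2) ℂ} (hc : γ 1 0 ≠ 0) : cConst γ ≠ 0 :=
  div_ne_zero γ.det_ne_zero (pow_ne_zero 2 hc)

lemma log_norm_deriv_mobius {γ : GL (Fin 2) ℂ} (hc : γ 1 0 ≠ 0) {z : ℂ} (hz : z ≠ pole γ) :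
    Real.log ‖deriv (mobius γ) z‖ = Real.log ‖cConst γ‖ - 2 * Real.log ‖z - pole γ‖ := by
  have h1 := norm_ne_zero_iff.2 (cConst_ne_zero hc)
  have h2 := norm_ne_zero_iff.2 (sub_ne_zero.2 hz)
  rw [(hasDerivAt_mobius hc hz).deriv, norm_div, norm_pow, Real.log_div h1 (pow_ne_zero 2 h2),
    Real.log_pow]
  norm_num

lemma dlog_deriv_mobius_apply {γ : GL (Fin 2) ℂ} (hc : γ 1 0 ≠ 0) {z : ℂ} (hz : z ≠ pole γ)
    (h : ℂ) : dlog (deriv (mobius γ)) z h = -2 / (z - pole γ) * h := by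
  have hs := sub_ne_zero.2 hz
  have hC := cConst_ne_zero hc
  have hev : deriv (mobius γ) =ᶠ[𝓝 z] fun w => cConst γ / (w - pole γ) ^ 2 := by
    filter_upwards [isOpen_ne.mem_nhds hz] with w hw
    exact (hasDerivAt_mobius hc hw).deriv
  have h1 : HasDerivAt (fun w => cConst γ / (w - pole γ) ^ 2)
      (-2 * cConst γ / (z - pole γ) ^ 3) z := by
    refine ((hasDerivAt_const z (cConst γ)).div (((hasDerivAt_id z).sub_const (pole γ)).pow 2)
      (pow_ne_zero 2 hs)).congr_deriv ?_
    simp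
    field_simp
  have h2 := (h1.congr_of_eventuallyEq hev).hasFDerivAt.restrictScalars ℝ
  rw [dlog, h2.fderiv, (hasDerivAt_mobius hc hz).deriv]
  simp
  field_simp

lemma piForm_dlog_deriv_mobius_apply {γ : GL (Fin 2) ℂ} (hc : γ 1 0 ≠ 0) {z : ℂ}
    (hz : z ≠ pole γ) (h : ℂ) :
    piForm 1 (dlog (deriv (mobius γ))) z h = I * ((-2 * (h / (z - pole γ)).im : ℝ) : ℂ) := by
  rw [piForm, ContinuousLinearMap.comp_apply, dlog_deriv_mobius_apply hc hz, piP_one_apply]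
  congr 2
  rw [show -2 / (z - pole γ) * h = ((-2 : ℝ) : ℂ) * (h / (z - pole γ)) by
    push_cast; ring, im_ofReal_mul]

lemma pole_mul_sub_pole {γ₁ γ₂ : GL (Fin 2) ℂ} (h₂ : γ₂ 1 0 ≠ 0) (h₁₂ : (γ₁ * γ₂) 1 0 ≠ 0) :
    pole (γ₁ * γ₂) - pole γ₂ =
      γ₁ 1 0 * (γ₂ : Matrix (Fin 2) (Fin 2) ℂ).det / ((γ₁ * γ₂) 1 0 * γ₂ 1 0) := by
  rw [pole, pole, Matrix.det_fin_two]
  rw [div_sub_div _ _ h₁₂ h₂]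
  congr 1
  simp only [Units.val_mul, Matrix.mul_apply, Fin.sum_univ_two]
  ring

/-- This encodes the chain rule for `(γ₁γ₂)'`, and is the relation that makes `κ` the right
correction term. -/
lemma cConst_mul_cConst {γ₁ γ₂ : GL (Fin 2) ℂ} (h₁ : γ₁ 1 0 ≠ 0) (h₂ : γ₂ 1 0 ≠ 0)
    (h₁₂ : (γ₁ * γ₂) 1 0 ≠ 0) :
    cConst (γ₁ * γ₂) * cConst γ₂ = (pole (γ₁ * γ₂) - pole γ₂) ^ 2 * cConst γ₁ := by
  rw [pole_mul_sub_pole h₂ h₁₂, cConst, cConst, cConst, Units.val_mul, Matrix.det_mul]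
  rw [Units.val_mul] at h₁₂
  field_simp

/-- The left side vanishes at `z₁₂` and has its pole at `z₂`, hence is a constant multiple of `T₁₂`.
-/
lemma mobius_sub_pole {γ₁ γ₂ : GL (Fin 2) ℂ} (h₁ : γ₁ 1 0 ≠ 0) (h₂ : γ₂ 1 0 ≠ 0)
    (h₁₂ : (γ₁ * γ₂) 1 0 ≠ 0) {z : ℂ} (hz : z ≠ pole γ₂) :
    mobius γ₂ z - pole γ₁ =
      (γ₁ * γ₂) 1 0 / (γ₁ 1 0 * γ₂ 1 0) * ((z - pole (γ₁ * γ₂)) / (z - pole γ₂)) := by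
  have hd : γ₂ 1 0 * z + γ₂ 1 1 ≠ 0 := fun h => hz <| by
    rw [pole, eq_div_iff h₂]
    linear_combination h
  have e : z - pole γ₂ = (γ₂ 1 0 * z + γ₂ 1 1) / γ₂ 1 0 := by
    rw [pole]
    field_simp
    ring
  have e' : z - pole (γ₁ * γ₂) = ((γ₁ * γ₂) 1 0 * z + (γ₁ * γ₂) 1 1) / (γ₁ * γ₂) 1 0 := by
    rw [pole]
    field_simp
    ring
  have e₁ : mobius γ₂ z - pole γ₁ = (γ₁ 1 0 * (γ₂ 0 0 * z + γ₂ 0 1)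
      + γ₁ 1 1 * (γ₂ 1 0 * z + γ₂ 1 1)) / (γ₁ 1 0 * (γ₂ 1 0 * z + γ₂ 1 1)) := by
    rw [mobius, pole, div_sub_div _ _ hd h₁]
    ring
  rw [e₁, e, e']
  generalize hw : γ₂ 1 0 * z + γ₂ 1 1 = w at hd
  field_simp
  simp only [Units.val_mul, Matrix.mul_apply, Fin.sum_univ_two]
  linear_combination -γ₁ 1 1 * hw

/-! ### The differential of `D2` off the cut. -/

lemma _root_.HasDerivAt.hasFDerivAt_im {f : ℂ → ℂ} {f' z : ℂ} (hf : HasDerivAt f f' z) :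
    HasFDerivAt (fun w => (f w).im) (imMul f') z := by
  have h := imCLM.hasFDerivAt.comp z (hf.hasFDerivAt.restrictScalars ℝ)
  refine h.congr_fderiv ?_
  ext w
  simp [mul_comm]

lemma hasFDerivAt_log_norm {z : ℂ} (hz : z ≠ 0) :
    HasFDerivAt (fun w : ℂ => Real.log ‖w‖) (imMul (I / z)) z := by
  -- Dividing by `z` brings the argument of `log` near `1`, away from its branch cut; multiplying by
  -- `I` turns the real part into an imaginary one, up to sign.
  have h1 : HasDerivAt (fun w : ℂ => I * log (w / z)) (I / z) z := by
    have h := (((hasDerivAt_id z).div_const z).clog (by simp [hz])).const_mul I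
    refine h.congr_deriv ?_
    simp [hz, div_eq_mul_inv]
  refine (h1.hasFDerivAt_im.add_const (Real.log ‖z‖)).congr_of_eventuallyEq ?_
  filter_upwards [isOpen_ne.mem_nhds hz] with w hw
  simp only [I_mul_im, log_re, norm_div]
  rw [Real.log_div (norm_ne_zero_iff.2 hw) (norm_ne_zero_iff.2 hz)]
  ring

lemma hasFDerivAt_arg_one_sub {z : ℂ} (hz : 1 - z ∈ slitPlane) :
    HasFDerivAt (fun w : ℂ => arg (1 - w)) (imMul (-1 / (1 - z))) z := by
  have h := (((hasDerivAt_id z).const_sub 1).clog hz).hasFDerivAt_im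
  simpa only [log_im, id] using h

/-- The coefficient `c` such that the differential of `D2` at `z` is `h ↦ Im (c h)`. -/
noncomputable def dD2Coeff (z : ℂ) : ℂ :=
  -(Real.log ‖z‖ / (1 - z)) - Real.log ‖1 - z‖ / z

lemma hasFDerivAt_D2_of_mem_slitPlane {z : ℂ} (hz : 1 - z ∈ slitPlane) (h0 : z ≠ 0) :
    HasFDerivAt D2 (imMul (dD2Coeff z)) z := by
  have h := ((hasFDerivAt_arg_one_sub hz).mul (hasFDerivAt_log_norm h0)).add
    (hasDerivAt_Li2 hz h0).hasFDerivAt_im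
  refine h.congr_fderiv ?_
  ext w
  -- The `arg (1 - z)` term here cancels the one from the product rule, leaving only single-valued
  -- coefficients.
  have e : -log (1 - z) / z * w = -(Real.log ‖1 - z‖ * (w / z)) - arg (1 - z) * (I / z * w) := by
    rw [log]
    ring
  have e' : dD2Coeff z * w = Real.log ‖z‖ * (-1 / (1 - z) * w) - Real.log ‖1 - z‖ * (w / z) := by
    rw [dD2Coeff]
    ring
  simp only [_root_.add_apply, _root_.smul_apply, imMul_apply, e, e',
    sub_im, neg_im, im_ofReal_mul, smul_eq_mul]
  ring

/-! ### Inversion, and differentiability across the cut. -/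

lemma dD2Coeff_inv {z : ℂ} (h0 : z ≠ 0) (h1 : z ≠ 1) :
    dD2Coeff z⁻¹ * (z ^ 2)⁻¹ = dD2Coeff z := by
  have h1' := sub_ne_zero.2 h1
  have h1'' := sub_ne_zero.2 h1.symm
  have e : 1 - z⁻¹ = (z - 1) / z := by field_simp
  have e2 : Real.log ‖1 - z⁻¹‖ = Real.log ‖1 - z‖ - Real.log ‖z‖ := by
    rw [e, norm_div, Real.log_div (norm_ne_zero_iff.2 h1') (norm_ne_zero_iff.2 h0), norm_sub_rev]
  rw [dD2Coeff, dD2Coeff, e2, e, norm_inv, Real.log_inv, ← neg_sub 1 z]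
  push_cast
  field_simp
  ring

lemma hasFDerivAt_neg_D2_inv {z : ℂ} (hz : 1 - z⁻¹ ∈ slitPlane) (h0 : z ≠ 0) :
    HasFDerivAt (fun w => -D2 w⁻¹) (imMul (dD2Coeff z)) z := by
  have h1 : z ≠ 1 := by
    rintro rfl
    simp at hz
  have h := ((hasFDerivAt_D2_of_mem_slitPlane hz (inv_ne_zero h0)).comp z
    ((hasDerivAt_inv h0).hasFDerivAt.restrictScalars ℝ)).neg
  refine h.congr_fderiv ?_
  ext w
  rw [← dD2Coeff_inv h0 h1]
  simp only [_root_.neg_apply, ContinuousLinearMap.comp_apply, imMul_apply,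
    ContinuousLinearMap.coe_restrictScalars', ContinuousLinearMap.toSpanSingleton_apply,
    smul_eq_mul, ← neg_im]
  congr 1
  ring

lemma one_sub_mem_slitPlane_of_im {z : ℂ} (hz : z.im ≠ 0) : 1 - z ∈ slitPlane :=
  Or.inr (by simpa using hz)

lemma inv_im_ne_zero {z : ℂ} (hz : z.im ≠ 0) : z⁻¹.im ≠ 0 := by
  have h0 : z ≠ 0 := by
    rintro rfl
    simp at hz
  rw [inv_im]
  exact div_ne_zero (neg_ne_zero.2 hz) (normSq_pos.2 h0).ne'

/-- By `dD2Coeff_inv`, `D2 z` and `-D2 z⁻¹` have the same differential off the real axis, so their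
difference is constant on connected pieces. -/
lemma D2_add_D2_inv_eq_of_convex {s : Set ℂ} (hs : Convex ℝ s) (ho : IsOpen s)
    (him : ∀ z ∈ s, z.im ≠ 0) {z w : ℂ} (hz : z ∈ s) (hw : w ∈ s) :
    D2 z + D2 z⁻¹ = D2 w + D2 w⁻¹ := by
  have hd : ∀ u ∈ s, HasFDerivAt (fun v => D2 v - -D2 v⁻¹) (0 : ℂ →L[ℝ] ℝ) u := fun u hu => by
    have h0 : u ≠ 0 := by
      rintro rfl
      exact him _ hu rfl
    have := (hasFDerivAt_D2_of_mem_slitPlane (one_sub_mem_slitPlane_of_im (him u hu)) h0).sub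
      (hasFDerivAt_neg_D2_inv (one_sub_mem_slitPlane_of_im (inv_im_ne_zero (him u hu))) h0)
    rwa [sub_self] at this
  have := ho.is_const_of_fderiv_eq_zero hs.isPreconnected
    (fun u hu => (hd u hu).differentiableAt.differentiableWithinAt)
    (fun u hu => (hd u hu).fderiv) hz hw
  simpa using this

lemma D2_neg_I : D2 (-I) = -D2 I := by
  rw [← conj_I, D2_conj (one_sub_mem_slitPlane_of_im (by simp))]

/-- The constant on each half-plane is found at `±I`, where inversion is conjugation and `D2`
changes sign. -/
lemma D2_inv_of_im_ne_zero {z : ℂ} (hz : z.im ≠ 0) : D2 z = -D2 z⁻¹ := by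
  rcases lt_or_gt_of_ne hz with h | h
  · have := D2_add_D2_inv_eq_of_convex (s := {w : ℂ | w.im < 0}) (convex_halfSpace_im_lt 0)
      (isOpen_lt continuous_im continuous_const) (fun w hw => ne_of_lt hw) (z := z) (w := -I) h
      (by simp)
    rw [inv_neg, inv_I, neg_neg, D2_neg_I] at this
    linarith
  · have := D2_add_D2_inv_eq_of_convex (s := {w : ℂ | 0 < w.im}) (convex_halfSpace_im_gt 0)
      (isOpen_lt continuous_const continuous_im) (fun w hw => ne_of_gt hw) (z := z) (w := I) h
      (by simp)
    rw [inv_I, D2_neg_I] at this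
    linarith

/-- The half-plane is an open neighbourhood of the cut, so the identity can be differentiated there.
At its real points both sides vanish. -/
lemma D2_inv_of_one_lt_re {z : ℂ} (hz : 1 < z.re) : D2 z = -D2 z⁻¹ := by
  by_cases h : z.im = 0
  · obtain ⟨x, rfl⟩ : ∃ x : ℝ, (x : ℂ) = z := ⟨z.re, Complex.ext rfl (by simp [h])⟩
    rw [ofReal_re] at hz
    rw [D2_ofReal_of_one_lt hz, ← ofReal_inv, D2_ofReal_of_lt_one (inv_lt_one_of_one_lt₀ hz),
      neg_zero]
  · exact D2_inv_of_im_ne_zero h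

/-- The Bloch–Wigner dilogarithm is differentiable off `0` and `1`. -/
theorem hasFDerivAt_D2 {z : ℂ} (h0 : z ≠ 0) (h1 : z ≠ 1) :
    HasFDerivAt D2 (imMul (dD2Coeff z)) z := by
  by_cases hz : 1 - z ∈ slitPlane
  · exact hasFDerivAt_D2_of_mem_slitPlane hz h0
  simp only [mem_slitPlane_iff, not_or, not_lt, not_not, sub_re, one_re, sub_im, one_im] at hz
  have him : z.im = 0 := by linarith [hz.2]
  obtain ⟨x, rfl⟩ : ∃ x : ℝ, (x : ℂ) = z := ⟨z.re, Complex.ext rfl (by simp [him])⟩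
  have hx : 1 < x := by
    refine lt_of_le_of_ne (by simpa using hz.1) ?_
    rintro rfl
    exact h1 ofReal_one
  have hs : 1 - ((x : ℂ))⁻¹ ∈ slitPlane := by
    refine Or.inl ?_
    rw [← ofReal_inv, sub_re, one_re, ofReal_re, sub_pos]
    exact inv_lt_one_of_one_lt₀ hx
  refine (hasFDerivAt_neg_D2_inv hs h0).congr_of_eventuallyEq ?_
  filter_upwards [(isOpen_lt continuous_const continuous_re).mem_nhds
    (show (1 : ℝ) < (x : ℂ).re from hx)] with w hw
  exact D2_inv_of_one_lt_re hw

/-! ### Composition with `T₁₂` and the coboundary of `κ`. -/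

lemma hasFDerivAt_L2_comp {f : ℂ → ℂ} {f' z : ℂ} (hf : HasDerivAt f f' z) (h0 : f z ≠ 0)
    (h1 : f z ≠ 1) :
    HasFDerivAt (L2 ∘ f) ((ContinuousLinearMap.mul ℝ ℂ I).comp
      (ofRealCLM.comp (imMul (dD2Coeff (f z) * f')))) z := by
  have h := (ContinuousLinearMap.mul ℝ ℂ I).hasFDerivAt.comp z (ofRealCLM.hasFDerivAt.comp z
    ((hasFDerivAt_D2 h0 h1).comp z (hf.hasFDerivAt.restrictScalars ℝ)))
  refine h.congr_fderiv ?_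
  ext w
  simp only [ContinuousLinearMap.comp_apply, imMul_apply,
    ContinuousLinearMap.coe_restrictScalars', ContinuousLinearMap.toSpanSingleton_apply,
    smul_eq_mul]
  rw [mul_comm w, mul_assoc]

lemma dD2Coeff_div {u v : ℂ} (hu : u ≠ 0) (hv : v ≠ 0) (hδ : v - u ≠ 0) :
    dD2Coeff (u / v) * ((v - u) / v ^ 2) =
      Real.log ‖v‖ / u - Real.log ‖u‖ / v + Real.log ‖v - u‖ * (1 / v - 1 / u) := by
  have nv := norm_ne_zero_iff.2 hv
  have e : 1 - u / v = (v - u) / v := by field_simp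
  rw [dD2Coeff, e, norm_div, norm_div, Real.log_div (norm_ne_zero_iff.2 hu) nv,
    Real.log_div (norm_ne_zero_iff.2 hδ) nv]
  push_cast
  field_simp
  ring

lemma hasDerivAt_T {γ₁ γ₂ : GL (Fin 2) ℂ} {z : ℂ} (hz : z ≠ pole γ₂) :
    HasDerivAt (T γ₁ γ₂)
      (((z - pole γ₂) - (z - pole (γ₁ * γ₂))) / (z - pole γ₂) ^ 2) z := by
  refine (((hasDerivAt_id z).sub_const (pole (γ₁ * γ₂))).div
    ((hasDerivAt_id z).sub_const (pole γ₂)) (sub_ne_zero.2 hz)).congr_deriv ?_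
  simp

lemma mobius_ne_pole {γ₁ γ₂ : GL (Fin 2) ℂ} (h₁ : γ₁ 1 0 ≠ 0) (h₂ : γ₂ 1 0 ≠ 0)
    (h₁₂ : (γ₁ * γ₂) 1 0 ≠ 0) {z : ℂ} (hz₂ : z ≠ pole γ₂) (hz₁₂ : z ≠ pole (γ₁ * γ₂)) :
    mobius γ₂ z ≠ pole γ₁ := by
  rw [← sub_ne_zero, mobius_sub_pole h₁ h₂ h₁₂ hz₂]
  exact mul_ne_zero (div_ne_zero h₁₂ (mul_ne_zero h₁ h₂))
    (div_ne_zero (sub_ne_zero.2 hz₁₂) (sub_ne_zero.2 hz₂))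

/-- Both sides are the logarithmic derivative of `T₁₂`, by `mobius_sub_pole`. It expresses the
pull-back of `κ_{γ₁}` through `d arg u - d arg v`. -/
lemma deriv_mobius_div_sub_pole {γ₁ γ₂ : GL (Fin 2) ℂ} (h₁ : γ₁ 1 0 ≠ 0) (h₂ : γ₂ 1 0 ≠ 0)
    (h₁₂ : (γ₁ * γ₂) 1 0 ≠ 0) {z : ℂ} (hz₂ : z ≠ pole γ₂) (hz₁₂ : z ≠ pole (γ₁ * γ₂)) :
    cConst γ₂ / (z - pole γ₂) ^ 2 / (mobius γ₂ z - pole γ₁) =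
      1 / (z - pole (γ₁ * γ₂)) - 1 / (z - pole γ₂) := by
  have hu := sub_ne_zero.2 hz₁₂
  have hv := sub_ne_zero.2 hz₂
  rw [mobius_sub_pole h₁ h₂ h₁₂ hz₂, div_sub_div _ _ hu hv,
    show 1 * (z - pole γ₂) - (z - pole (γ₁ * γ₂)) * 1 = pole (γ₁ * γ₂) - pole γ₂ by ring,
    pole_mul_sub_pole h₂ h₁₂, cConst]
  field_simp

lemma pullback_kappa_apply {Γ : Subgroup (GL (Fin 2) ℂ)} {γ₁ : Γ} {γ₂ : GL (Fin 2) ℂ}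
    (h₁ : (γ₁ : GL (Fin 2) ℂ) 1 0 ≠ 0) (h₂ : γ₂ 1 0 ≠ 0)
    (h₁₂ : ((γ₁ : GL (Fin 2) ℂ) * γ₂) 1 0 ≠ 0) {z : ℂ} (hz₂ : z ≠ pole γ₂)
    (hz₁₂ : z ≠ pole ((γ₁ : GL (Fin 2) ℂ) * γ₂)) (h : ℂ) :
    pullback (kappa γ₁) γ₂ z h = Real.log ‖cConst γ₁‖ * (I * ((-2 *
      ((h / (z - pole ((γ₁ : GL (Fin 2) ℂ) * γ₂))).im - (h / (z - pole γ₂)).im) : ℝ) : ℂ)) := by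
  have hf : fderiv ℝ (mobius γ₂) z h = h * (cConst γ₂ / (z - pole γ₂) ^ 2) := by
    rw [((hasDerivAt_mobius h₂ hz₂).hasFDerivAt.restrictScalars ℝ).fderiv]
    simp
  rw [pullback, ContinuousLinearMap.comp_apply, hf, kappa, _root_.smul_apply,
    piForm_dlog_deriv_mobius_apply h₁ (mobius_ne_pole h₁ h₂ h₁₂ hz₂ hz₁₂), mul_div_assoc h,
    deriv_mobius_div_sub_pole h₁ h₂ h₁₂ hz₂ hz₁₂, mul_sub, mul_one_div, mul_one_div, sub_im,
    real_smul]

lemma log_norm_cConst_add {γ₁ γ₂ : GL (Fin 2) ℂ} (h₁ : γ₁ 1 0 ≠ 0) (h₂ : γ₂ 1 0 ≠ 0)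
    (h₁₂ : (γ₁ * γ₂) 1 0 ≠ 0) :
    Real.log ‖cConst (γ₁ * γ₂)‖ + Real.log ‖cConst γ₂‖ =
      2 * Real.log ‖pole (γ₁ * γ₂) - pole γ₂‖ + Real.log ‖cConst γ₁‖ := by
  have hδ : pole (γ₁ * γ₂) - pole γ₂ ≠ 0 := by
    rw [pole_mul_sub_pole h₂ h₁₂]
    exact div_ne_zero (mul_ne_zero h₁ γ₂.det_ne_zero) (mul_ne_zero h₁₂ h₂)
  rw [← Real.log_mul (norm_ne_zero_iff.2 (cConst_ne_zero h₁₂))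
    (norm_ne_zero_iff.2 (cConst_ne_zero h₂)), ← norm_mul, cConst_mul_cConst h₁ h₂ h₁₂, norm_mul,
    norm_pow, Real.log_mul (pow_ne_zero 2 (norm_ne_zero_iff.2 hδ))
    (norm_ne_zero_iff.2 (cConst_ne_zero h₁)), Real.log_pow]
  norm_num

end BlochWigner

theorem mainTheorem11
    (Γ : Subgroup (GL (Fin 2) ℂ)) (γ₁ γ₂ : Γ)
    (h₁ : (γ₁ : GL (Fin 2) ℂ) • (OnePoint.infty : OnePoint ℂ) ≠ OnePoint.infty)
    (h₂ : (γ₂ : GL (Fin 2) ℂ) • (OnePoint.infty : OnePoint ℂ) ≠ OnePoint.infty)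
    (h₁₂ : ((γ₁ * γ₂ : Γ) : GL (Fin 2) ℂ) • (OnePoint.infty : OnePoint ℂ) ≠ OnePoint.infty)
    (z : ℂ)
    (hz₂ : z ≠ BlochWigner.pole γ₂)
    (hz₁₂ : z ≠ BlochWigner.pole ((γ₁ * γ₂ : Γ) : GL (Fin 2) ℂ)) :
    DifferentiableAt ℝ (BlochWigner.L2 ∘ BlochWigner.T γ₁ γ₂) z ∧
    BlochWigner.r2 (deriv (BlochWigner.mobius ((γ₁ * γ₂ : Γ) : GL (Fin 2) ℂ)))
        (deriv (BlochWigner.mobius γ₂)) z =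
      (4 : ℝ) • fderiv ℝ (BlochWigner.L2 ∘ BlochWigner.T γ₁ γ₂) z
        + BlochWigner.coboundary BlochWigner.kappa γ₁ γ₂ z := by
  open BlochWigner in
  rw [Ne, OnePoint.smul_infty_eq_self_iff] at h₁ h₂ h₁₂
  have hz₁₂' : z ≠ pole ((γ₁ : GL (Fin 2) ℂ) * γ₂) := hz₁₂
  have h₁₂' : ((γ₁ : GL (Fin 2) ℂ) * γ₂) 1 0 ≠ 0 := h₁₂
  have hu := sub_ne_zero.2 hz₁₂'
  have hv := sub_ne_zero.2 hz₂
  -- The poles differ because `γ₁` moves `∞`; hence `T₁₂` never takes the value `1`.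
  have hδ : pole ((γ₁ : GL (Fin 2) ℂ) * γ₂) - pole γ₂ ≠ 0 := by
    rw [pole_mul_sub_pole h₂ h₁₂']
    exact div_ne_zero (mul_ne_zero h₁ (γ₂ : GL (Fin 2) ℂ).det_ne_zero) (mul_ne_zero h₁₂' h₂)
  have hsub : (z - pole γ₂) - (z - pole ((γ₁ : GL (Fin 2) ℂ) * γ₂)) =
      pole ((γ₁ : GL (Fin 2) ℂ) * γ₂) - pole γ₂ := by ring
  have hT1 : T γ₁ γ₂ z ≠ 1 := fun h => hδ <| by
    rw [T, div_eq_one_iff_eq hv] at h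
    rw [← hsub, h, sub_self]
  have hL := hasFDerivAt_L2_comp (hasDerivAt_T (γ₁ := γ₁) hz₂) (div_ne_zero hu hv) hT1
  refine ⟨hL.differentiableAt, ?_⟩
  ext h
  have hlog := log_norm_cConst_add h₁ h₂ h₁₂'
  have hD := dD2Coeff_div hu hv (hsub ▸ hδ)
  rw [hL.fderiv, T, hD, hsub]
  simp only [r2, coboundary, kappa, sub_apply, add_apply, smul_apply,
    ContinuousLinearMap.comp_apply, pullback_kappa_apply h₁ h₂ h₁₂' hz₂ hz₁₂',
    piForm_dlog_deriv_mobius_apply h₂ hz₂, piForm_dlog_deriv_mobius_apply h₁₂' hz₁₂',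
    log_norm_deriv_mobius h₂ hz₂, log_norm_deriv_mobius h₁₂' hz₁₂', imMul_apply,
    Complex.ofRealCLM_apply, ContinuousLinearMap.mul_apply', Subgroup.coe_mul]
  generalize hδe : pole ((γ₁ : GL (Fin 2) ℂ) * γ₂) - pole γ₂ = δ at *
  generalize z - pole ((γ₁ : GL (Fin 2) ℂ) * γ₂) = u at *
  generalize z - pole (γ₂ : GL (Fin 2) ℂ) = v at *
  have e : (((Real.log ‖v‖ : ℂ) / u - Real.log ‖u‖ / v + Real.log ‖δ‖ * (1 / v - 1 / u)) * h).im =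
      Real.log ‖v‖ * (h / u).im - Real.log ‖u‖ * (h / v).im +
        Real.log ‖δ‖ * ((h / v).im - (h / u).im) := by
    rw [← Complex.sub_im, ← Complex.im_ofReal_mul, ← Complex.im_ofReal_mul,
      ← Complex.im_ofReal_mul, ← Complex.sub_im, ← Complex.add_im]
    congr 1
    ring
  rw [e]
  simp only [Complex.real_smul]
  have hlog' := congrArg (fun x : ℝ => (x : ℂ)) hlog
  push_cast at hlog' ⊢
  -- The terms in `log|u|` and `log|v|` cancel. What remains is `2i (d arg v - d arg u)` times
  -- `log|c₁₂| + log|c₂| - 2 log|δ| - log|c₁|`.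
  linear_combination (2 * Complex.I * ((h / v).im - (h / u).im)) * hlog'
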